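/- **Notation.** $\overline D(z,r)$ is the closed disk in $\mathbb C$ with center $z$ and radius $r$. For a real matrix $A=\begin{bmatrix}a&b\\c&d\end{bmatrix}$ the chiral disk is \[\mathrm{CD}(A)=\overline D\left(\tfrac{a+d}2+\tfrac{c-b}2\mathrm i,\ \sqrt{\left(\tfrac{a-d}2\right)^2+\left(\tfrac{b+c}2\right)^2}\right).\] Let $C(x)=\cosh\sqrt x$, $S(x)=\frac{\sinh\sqrt x}{\sqrt x}$ for $x>0$; $C(0)=S(0)=1$; $C(x)=\cos\sqrt{-x}$, $S(x)=\frac{\sin\sqrt{-x}}{\sqrt{-x}}$ for $x<0$; and \[W(p,w)=\begin{bmatrix}\cos w&-\sin w\\\sin w&\cos w\end{bmatrix}\begin{bmatrix}C(p^2-w^2)&(p+w)S(p^2-w^2)\\(p-w)S(p^2-w^2)&C(p^2-w^2)\end{bmatrix}.\] For $s\in\mathbb R$ let $\Phi_s(\theta)=\begin{bmatrix}-\sin(2\theta s)&\cos(2\theta s)\\\cos(2\theta s)&\sin(2\theta s)\end{bmatrix}$, and let \[\mathrm{Lexp}(\Phi_s|_{[0,p]})=\mathrm{Id}+\sum_{n\ge1}\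 \int_{p\ge\theta_1\ge\dots\ge\theta_n\ge0}\Phi_s(\theta_1)\cdots\Phi_s(\theta_n)\,\mathrm d\theta_1\cdots\mathrm d\theta_n\] be its left time-ordered exponential (the hyperbolic development). **Theorem.** Let $0<p<\pi$. Put $\gamma_p(t)=\mathrm e^{p\cos t+\mathrm ip\sin t}$ and \[\Omega_p(t)=\mathrm e^{\mathrm ip\sin t}\left(\cosh(p\cos t)-\mathrm i\,\frac{\sinh(p\cos t)\sin t}{\cos t}\right),\qquad \omega_p(t)=\frac{\sinh(p\cos t)}{\cos t}\qquad\text{if }\cos t\ne0,\] \[\Omega_p(\pm\pi/2)=(\cos p+p\sin p)\pm\mathrm i(\sin p-p\cos p),\qquad\omega_p(\pm\pi/2)=p.\] (a) Let $t\in[-\pi/2,\pi/2]$. Then $\omega_p(t)>0$, and the circle $\partial\overline D(\Omega_p(t),\omega_p(t))$ is tangent to $\partial\exp\overline D(0,p)$ at $\gamma_p(t)$ and at $\gamma_p(\pi-t)=\mathrm e^{-p\cos t+\mathrm ip\sin t}$. These two points are inverses of each other relative to the unit circle. They are equal if and only if $t=\pm\pi/2$, and in that case $\overline D(\Omega_p(t),\omega_p(t))$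 is the osculating disk of $\partial\exp\overline D(0,p)$ at $\gamma_p(t)$. The circle $\partial\overline D(\Omega_p(t),\omega_p(t))$ is orthogonal to the unit circle. The disks belonging to different $t\in[-\pi/2,\pi/2]$ are distinct. If $\Omega_p$ and $\omega_p$ are extended to $t\in[-\pi,\pi]$ by the same formulas, then $\Omega_p(t)=\Omega_p(s)$ and $\omega_p(t)=\omega_p(s)$ whenever $s,t\in[-\pi,\pi]$ and $s\equiv\pi-t\pmod{2\pi}$. (b) For $t\in[-\pi/2,\pi/2]$ the series defining $\mathrm{Lexp}(\Phi_{\sin t}|_{[0,p]})$ is summable, and \[\mathrm{CD}(\mathrm{Lexp}(\Phi_{\sin t}|_{[0,p]}))=\mathrm{CD}(W(p,p\sin t))=\overline D(\Omega_p(t),\omega_p(t)).\] (c) The disks $\overline D(\Omega_p(t),\omega_p(t))$, $t\in[-\pi/2,\pi/2]$, are exactly the maximal disks in $\exp\overline D(0,p)$, i.e. the maximal elements, with respect to inclusion, of the set of all closed disks (points allowed) contained in $\exp\overline D(0,p)$. For each $t\in[-\pi/2,\pi/2]$, \[\overline D(\Omega_p(t),\omega_p(t))\cap\partial\exp\overline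 D(0,p)=\{\gamma_p(t),\gamma_p(\pi-t)\}.\] -/

import Mathlib

open scoped Topology Matrix

noncomputable section

namespace MagnusDisks

/-! ### The curve, the region, and the family of disks -/

/-- The set `exp D̄(0,p)`. -/
def expDisk (p : ℝ) : Set ℂ := Complex.exp '' Metric.closedBall (0 : ℂ) p

/-- `γ_p(t) = e^{p cos t + i p sin t}`. -/
def gam (p t : ℝ) : ℂ :=
  Complex.exp (((p * Real.cos t : ℝ) : ℂ) + Complex.I * ((p * Real.sin t : ℝ) : ℂ))

/-- The centers `Ω_p(t)`. For `t ∈ [-π, π]` the case `cos t = 0` means `t = ± π/2`, and then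
`sin t = ± 1` is the sign in `Ω_p(± π/2) = (cos p + p sin p) ± i (sin p - p cos p)`. -/
def Omega (p t : ℝ) : ℂ :=
  if Real.cos t = 0 then
    ((Real.cos p + p * Real.sin p : ℝ) : ℂ)
      + ((Real.sin t * (Real.sin p - p * Real.cos p) : ℝ) : ℂ) * Complex.I
  else
    Complex.exp (Complex.I * ((p * Real.sin t : ℝ) : ℂ)) *
      (((Real.cosh (p * Real.cos t) : ℝ) : ℂ)
        - Complex.I * ((Real.sinh (p * Real.cos t) * Real.sin t / Real.cos t : ℝ) : ℂ))

/-- The radii `ω_p(t)`. -/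
def omega (p t : ℝ) : ℝ :=
  if Real.cos t = 0 then p else Real.sinh (p * Real.cos t) / Real.cos t

/-- The closed disk `D̄(Ω_p(t), ω_p(t))`. -/
def disk (p t : ℝ) : Set ℂ := Metric.closedBall (Omega p t) (omega p t)

/-- `D` is a closed disk, possibly reduced to a point, which is contained in `K`. -/
def IsDiskIn (K D : Set ℂ) : Prop :=
  (∃ (c : ℂ) (r : ℝ), 0 ≤ r ∧ D = Metric.closedBall c r) ∧ D ⊆ K

/-- `D` is a maximal disk in `K`: maximal, for inclusion, among the closed disks in `K`. -/
def IsMaximalDiskIn (K D : Set ℂ) : Prop := Maximal (IsDiskIn K) D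

/-! ### Tangency, osculation, orthogonality -/

/-- `c`, near the parameter `0`, is a regular `C²` parametrization of the set `S` near its point
`z`: small neighbourhoods of `0` are mapped exactly onto small neighbourhoods of `z` in `S`. -/
structure IsLocalParam (c : ℝ → ℂ) (S : Set ℂ) (z : ℂ) : Prop where
  map_zero : c 0 = z
  contDiffAt : ContDiffAt ℝ 2 c 0
  deriv_ne_zero : deriv c 0 ≠ 0
  map_nhds : Filter.map c (𝓝 0) = 𝓝[S] z

/-- The sets `S` and `T` are regular plane curves near their common point `z`, where they have the
same tangent line. -/
def IsTangentAt (S T : Set ℂ) (z : ℂ) : Prop :=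
  ∃ c d : ℝ → ℂ, IsLocalParam c S z ∧ IsLocalParam d T z ∧
    ∃ a : ℝ, a ≠ 0 ∧ deriv c 0 = a • deriv d 0

/-- The oriented curvature `det(c', c'') / |c'|³` of a plane curve. -/
def signedCurvature (c : ℝ → ℂ) (s : ℝ) : ℝ :=
  ((starRingEnd ℂ) (deriv c s) * deriv (deriv c) s).im / ‖deriv c s‖ ^ 3

/-- The disk `D̄(w,r)` is the osculating disk of the plane curve `S` at `z`: its radius is the
radius of curvature of `S` at `z`, and its center is the center of curvature `z + κ⁻¹ N`, where
`N = i c' / |c'|`. -/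
def IsOsculatingDisk (w : ℂ) (r : ℝ) (S : Set ℂ) (z : ℂ) : Prop :=
  ∃ c : ℝ → ℂ, IsLocalParam c S z ∧ signedCurvature c 0 ≠ 0 ∧
    w = z + (signedCurvature c 0)⁻¹ • (Complex.I * (deriv c 0 / ((‖deriv c 0‖ : ℝ) : ℂ))) ∧
    r = |signedCurvature c 0|⁻¹

/-- The circles `∂D̄(w₁,r₁)` and `∂D̄(w₂,r₂)` are orthogonal: they intersect, and at each
intersection point their radii are perpendicular. -/
def CirclesOrthogonal (w₁ : ℂ) (r₁ : ℝ) (w₂ : ℂ) (r₂ : ℝ) : Prop :=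
  (Metric.sphere w₁ r₁ ∩ Metric.sphere w₂ r₂).Nonempty ∧
    ∀ z ∈ Metric.sphere w₁ r₁ ∩ Metric.sphere w₂ r₂, inner ℝ (z - w₁) (z - w₂) = 0

/-! ### Chiral disks and hyperbolic developments -/

/-- The chiral disk of a real matrix with rows `(a, b)` and `(c, d)`: the closed disk with center
`(a+d)/2 + i (c-b)/2` and radius `√(((a-d)/2)² + ((b+c)/2)²)`. -/
def chiralDisk (A : Matrix (Fin 2) (Fin 2) ℝ) : Set ℂ :=
  Metric.closedBall
    ((((A 0 0 + A 1 1) / 2 : ℝ) : ℂ) + (((A 1 0 - A 0 1) / 2 : ℝ) : ℂ) * Complex.I)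
    (Real.sqrt (((A 0 0 - A 1 1) / 2) ^ 2 + ((A 0 1 + A 1 0) / 2) ^ 2))

/-- The entire function `cosh √x` on the real line. -/
def CC (x : ℝ) : ℝ :=
  if x < 0 then Real.cos (Real.sqrt (-x)) else if x = 0 then 1 else Real.cosh (Real.sqrt x)

/-- The entire function `sinh √x / √x` on the real line. -/
def SS (x : ℝ) : ℝ :=
  if x < 0 then Real.sin (Real.sqrt (-x)) / Real.sqrt (-x)
  else if x = 0 then 1 else Real.sinh (Real.sqrt x) / Real.sqrt x

/-- The matrix `W(p,w)`. -/
def W (p w : ℝ) : Matrix (Fin 2) (Fin 2) ℝ :=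
  !![Real.cos w, -Real.sin w; Real.sin w, Real.cos w] *
    !![CC (p ^ 2 - w ^ 2), (p + w) * SS (p ^ 2 - w ^ 2);
       (p - w) * SS (p ^ 2 - w ^ 2), CC (p ^ 2 - w ^ 2)]

/-- The density, at time `θ`, of the hyperbolic development with speed `s`. -/
def Phi (s θ : ℝ) : Matrix (Fin 2) (Fin 2) ℝ :=
  !![-Real.sin (2 * (θ * s)), Real.cos (2 * (θ * s));
     Real.cos (2 * (θ * s)), Real.sin (2 * (θ * s))]

/-- The `n`-th term of the left time-ordered exponential of the matrix-valued measure
`φ(θ) dθ` on `[a,x]`: the iterated integral of `φ(θ₁) φ(θ₂) ⋯ φ(θₙ)` over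
`x ≥ θ₁ ≥ θ₂ ≥ ⋯ ≥ θₙ ≥ a` (integration is entrywise). -/
def lexpTerm (φ : ℝ → Matrix (Fin 2) (Fin 2) ℝ) (a : ℝ) : ℕ → ℝ → Matrix (Fin 2) (Fin 2) ℝ
  | 0, _ => 1
  | n + 1, x => Matrix.of fun i j => ∫ θ in a..x, (φ θ * lexpTerm φ a n θ) i j

/-- The left time-ordered exponential of `φ(θ) dθ` on `[a,b]`. -/
def lexp (φ : ℝ → Matrix (Fin 2) (Fin 2) ℝ) (a b : ℝ) : Matrix (Fin 2) (Fin 2) ℝ :=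
  ∑' n : ℕ, lexpTerm φ a n b

end MagnusDisks

end

open MagnusDisks

/-!
In the coordinates `u + i y = log z` the region `exp D̄(0, p)` is `cosh u ≤ C(p² - y²)`, and the
disk with parameter `t` is `cosh u ≤ h(y)`, where `h` is the solution of `h'' + h = 0` tangent to
the profile `f(y) = C(p² - y²)` at `y = p sin t`. As `p < π`, the profile satisfies `f'' + f > 0` on
`(-π, π)`, so by variation of constants it lies above `h`, strictly so away from the point of
tangency. Hence the disk lies in the region and touches its boundary only at `γ_p(t)` and
`γ_p(π - t)`.

Conversely, every disk in the region grows to one that meets the boundary, say at `γ_p(t)`, and then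
its center lies on the inner normal there. If its radius exceeded `ω_p(t)`, it would contain
the boundary point `γ_p(π - t)` in its interior, unless the two boundary points coincide; then the
comparison of curvatures bounds the radius instead.

For (b), `x ↦ W(x, x s)` is a rotation times the exponential of `x [[0, 1 + s], [1 - s, 0]]`.
Passing to the rotating frame shows that it solves `A' = Φ_s A`, `A(0) = 1`, and iterating the
corresponding integral equation expands such a solution into the time-ordered exponential.
-/

namespace MagnusDisks

open Filter Metric Set
open scoped Real

/-! ### The functions `CC` and `SS` -/

lemma CC_of_nonneg {x : ℝ} (hx : 0 ≤ x) : CC x = Real.cosh √x := by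
  rcases hx.eq_or_lt with rfl | hx
  · simp [CC]
  · rw [CC, if_neg hx.not_gt, if_neg hx.ne']

lemma CC_of_nonpos {x : ℝ} (hx : x ≤ 0) : CC x = Real.cos √(-x) := by
  rcases hx.eq_or_lt with rfl | hx
  · simp [CC]
  · rw [CC, if_pos hx]

lemma CC_sq (r : ℝ) : CC (r ^ 2) = Real.cosh r := by
  rw [CC_of_nonneg (sq_nonneg r), Real.sqrt_sq_eq_abs, Real.cosh_abs]

lemma CC_neg_sq (r : ℝ) : CC (-r ^ 2) = Real.cos r := by
  rw [CC_of_nonpos (neg_nonpos.2 (sq_nonneg r)), neg_neg, Real.sqrt_sq_eq_abs, Real.cos_abs]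

lemma mul_SS_sq (r : ℝ) : r * SS (r ^ 2) = Real.sinh r := by
  rcases eq_or_ne r 0 with rfl | hr
  · simp
  have h : 0 < r ^ 2 := by positivity
  rw [SS, if_neg h.not_gt, if_neg h.ne', Real.sqrt_sq_eq_abs]
  rcases abs_choice r with h | h <;> rw [h] <;> simp [mul_div_cancel₀, hr]

lemma mul_SS_neg_sq (r : ℝ) : r * SS (-r ^ 2) = Real.sin r := by
  rcases eq_or_ne r 0 with rfl | hr
  · simp
  have h : -r ^ 2 < 0 := neg_lt_zero.2 (by positivity)
  rw [SS, if_pos h, neg_neg, Real.sqrt_sq_eq_abs]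
  rcases abs_choice r with h | h <;> rw [h] <;> simp [mul_div_cancel₀, hr]

lemma CC_zero : CC 0 = 1 := by simp [CC]

lemma SS_zero : SS 0 = 1 := by simp [SS]

lemma exists_eq_sq_or_eq_neg_sq (x : ℝ) : ∃ r, 0 ≤ r ∧ (x = r ^ 2 ∨ x = -r ^ 2) := by
  rcases le_total 0 x with h | h
  · exact ⟨√x, Real.sqrt_nonneg x, .inl (Real.sq_sqrt h).symm⟩
  · exact ⟨√(-x), Real.sqrt_nonneg _, .inr (by rw [Real.sq_sqrt (neg_nonneg.2 h), neg_neg])⟩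

@[fun_prop]
lemma continuous_CC : Continuous CC := by
  have h : CC = fun x => Real.cosh √x + Real.cos √(-x) - 1 := by
    funext x
    rcases le_total 0 x with hx | hx
    · simp [CC_of_nonneg hx, Real.sqrt_eq_zero_of_nonpos (neg_nonpos.2 hx)]
    · simp [CC_of_nonpos hx, Real.sqrt_eq_zero_of_nonpos hx]
  rw [h]
  fun_prop

lemma hasDerivAt_mul_SS (c x : ℝ) :
    HasDerivAt (fun x => x * SS (c * x ^ 2)) (CC (c * x ^ 2)) x := by
  obtain ⟨k, hk, hc⟩ := exists_eq_sq_or_eq_neg_sq c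
  rcases hk.eq_or_lt with rfl | hk
  · obtain rfl : c = 0 := by simpa using hc
    simpa only [zero_mul, SS_zero, CC_zero, mul_one] using hasDerivAt_id' x
  have hkx : HasDerivAt (fun x : ℝ => k * x) k x := by simpa using (hasDerivAt_id x).const_mul k
  rcases hc with rfl | rfl
  · simp only [← mul_pow, CC_sq]
    refine ((hkx.sinh.div_const k).congr_deriv (by field_simp)).congr_of_eventuallyEq
      (.of_forall fun y => ?_)
    simp only [← mul_SS_sq]
    field_simp
  · simp only [neg_mul, ← mul_pow, CC_neg_sq]
    refine ((hkx.sin.div_const k).congr_deriv (by field_simp)).congr_of_eventuallyEq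
      (.of_forall fun y => ?_)
    simp only [← mul_SS_neg_sq]
    field_simp

lemma SS_eq_integral (x : ℝ) : SS x = ∫ t in (0 : ℝ)..1, CC (x * t ^ 2) := by
  rw [intervalIntegral.integral_eq_sub_of_hasDerivAt (fun t _ => hasDerivAt_mul_SS x t)
    (Continuous.intervalIntegrable (by fun_prop) 0 1)]
  simp

@[fun_prop]
lemma continuous_SS : Continuous SS := by
  have h : Continuous fun x => ∫ t in (0 : ℝ)..1, CC (x * t ^ 2) :=
    intervalIntegral.continuous_parametric_intervalIntegral_of_continuous'
      (f := fun x t => CC (x * t ^ 2)) (by fun_prop) 0 1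
  simpa only [← SS_eq_integral] using h

lemma hasDerivAt_CC (x : ℝ) : HasDerivAt CC (SS x / 2) x := by
  refine hasDerivAt_of_hasDerivAt_of_ne' (x := 0) (g := fun x => SS x / 2) (fun y hy => ?_)
    continuous_CC.continuousAt (continuous_SS.div_const 2).continuousAt x
  rcases hy.lt_or_gt with hy | hy
  · refine (((hasDerivAt_neg y).sqrt (neg_pos.2 hy).ne').cos.congr_deriv ?_).congr_of_eventuallyEq
      ((eventually_lt_nhds hy).mono fun z hz => CC_of_nonpos hz.le)
    rw [SS, if_pos hy]
    ring
  · refine ((Real.hasDerivAt_sqrt hy.ne').cosh.congr_deriv ?_).congr_of_eventuallyEq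
      ((eventually_gt_nhds hy).mono fun z hz => CC_of_nonneg hz.le)
    rw [SS, if_neg hy.not_gt, if_neg hy.ne']
    ring

lemma hasDerivAt_intervalIntegral_of_continuous {f f' : ℝ → ℝ → ℝ} (a b x : ℝ)
    (hf : ∀ x, Continuous (f x)) (hf' : Continuous f'.uncurry)
    (h : ∀ x t, HasDerivAt (f · t) (f' x t) x) :
    HasDerivAt (fun x => ∫ t in a..b, f x t) (∫ t in a..b, f' x t) x := by
  obtain ⟨K, hK⟩ := ((isCompact_closedBall x 1).prod (isCompact_uIcc (a := a) (b := b))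
    ).exists_bound_of_continuousOn hf'.continuousOn
  refine (intervalIntegral.hasDerivAt_integral_of_dominated_loc_of_deriv_le (bound := fun _ => K)
    (closedBall_mem_nhds x one_pos) (.of_forall fun y => (hf y).aestronglyMeasurable)
    ((hf x).intervalIntegrable a b) (hf'.comp (by fun_prop : Continuous fun t => (x, t))
      |>.aestronglyMeasurable) (.of_forall fun t ht y hy => ?_)
    intervalIntegrable_const (.of_forall fun t _ y _ => h y t)).2
  exact hK (y, t) ⟨hy, uIoc_subset_uIcc ht⟩

lemma hasDerivAt_SS (x : ℝ) :
    HasDerivAt SS ((∫ t in (0 : ℝ)..1, t ^ 2 * SS (x * t ^ 2)) / 2) x := by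
  have h := hasDerivAt_intervalIntegral_of_continuous (f := fun x t => CC (x * t ^ 2))
    (f' := fun x t => t ^ 2 * SS (x * t ^ 2) / 2) 0 1 x
    (fun _ => by fun_prop) (by fun_prop)
    (fun x t => ((hasDerivAt_CC _).comp x (hasDerivAt_mul_const (t ^ 2))).congr_deriv (by ring))
  simpa only [← SS_eq_integral, intervalIntegral.integral_div] using h

lemma CC_sub_SS (x : ℝ) : CC x - SS x = 2 * x * deriv SS x := by
  have hderiv : ∀ t : ℝ, HasDerivAt (fun t => t * CC (x * t ^ 2))
      (CC (x * t ^ 2) + x * (t ^ 2 * SS (x * t ^ 2))) t := fun t => by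
    have h := (hasDerivAt_CC (x * t ^ 2)).comp t ((hasDerivAt_pow 2 t).const_mul x)
    refine ((hasDerivAt_id t).mul h).congr_deriv ?_
    simp only [id_eq, Function.comp_apply]
    ring
  have hCC : Continuous fun t => CC (x * t ^ 2) := by fun_prop
  have hSS : Continuous fun t => x * (t ^ 2 * SS (x * t ^ 2)) := by fun_prop
  have h := intervalIntegral.integral_eq_sub_of_hasDerivAt (fun t _ => hderiv t)
    ((hCC.add hSS).intervalIntegrable 0 1)
  rw [intervalIntegral.integral_add (hCC.intervalIntegrable 0 1) (hSS.intervalIntegrable 0 1),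
    intervalIntegral.integral_const_mul, ← SS_eq_integral] at h
  rw [(hasDerivAt_SS x).deriv]
  simp only [one_pow, mul_one, one_mul, zero_mul, sub_zero] at h
  linarith

lemma SS_pos {x : ℝ} (hx : -π ^ 2 < x) : 0 < SS x := by
  obtain ⟨r, hr, h⟩ := exists_eq_sq_or_eq_neg_sq x
  rcases hr.eq_or_lt with rfl | hr
  · obtain rfl : x = 0 := by simpa using h
    simp [SS_zero]
  refine pos_of_mul_pos_right ?_ hr.le
  rcases h with rfl | rfl
  · rw [mul_SS_sq]
    exact Real.sinh_pos_iff.2 hr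
  · rw [mul_SS_neg_sq]
    exact Real.sin_pos_of_pos_of_lt_pi hr (lt_of_pow_lt_pow_left₀ 2 Real.pi_pos.le (by linarith))

lemma deriv_SS_pos {x : ℝ} (hx : -π ^ 2 < x) : 0 < deriv SS x := by
  rw [(hasDerivAt_SS x).deriv]
  refine half_pos (intervalIntegral.intervalIntegral_pos_of_pos_on
    (Continuous.intervalIntegrable (by fun_prop) 0 1)
    (fun t ht => mul_pos (pow_pos ht.1 2) (SS_pos ?_)) one_pos)
  have ht2 : t ^ 2 ≤ 1 := pow_le_one₀ ht.1.le ht.2.le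
  have ht0 : 0 < t ^ 2 := pow_pos ht.1 2
  nlinarith [sq_nonneg π]

lemma strictMonoOn_CC : StrictMonoOn CC (Ici (-π ^ 2)) := by
  refine strictMonoOn_of_deriv_pos (convex_Ici _) continuous_CC.continuousOn fun x hx => ?_
  rw [interior_Ici] at hx
  rw [(hasDerivAt_CC x).deriv]
  exact half_pos (SS_pos hx)

/-! ### The boundary profile in logarithmic coordinates -/

/-- In the coordinates `u + i y = log z`, the region `expDisk p` is `cosh u ≤ profile p y`. -/
noncomputable def profile (p y : ℝ) : ℝ := CC (p ^ 2 - y ^ 2)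

/-- The sinusoid tangent to `profile p` at `σ`, as a function of `v = y - σ`. In the coordinates
`u + i y = log z`, the disk touching the boundary at height `σ` is
`cosh u ≤ tangentProfile p σ (y - σ)`. -/
noncomputable def tangentProfile (p σ v : ℝ) : ℝ :=
  profile p σ * Real.cos v - σ * SS (p ^ 2 - σ ^ 2) * Real.sin v

lemma hasDerivAt_profile (p y : ℝ) : HasDerivAt (profile p) (-y * SS (p ^ 2 - y ^ 2)) y := by
  refine ((hasDerivAt_CC _).comp y ((hasDerivAt_pow 2 y).const_sub (p ^ 2))).congr_deriv ?_
  norm_num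
  ring

lemma hasDerivAt_neg_mul_SS (p y : ℝ) : HasDerivAt (fun y => -y * SS (p ^ 2 - y ^ 2))
    (2 * p ^ 2 * deriv SS (p ^ 2 - y ^ 2) - profile p y) y := by
  have hSS := (hasDerivAt_SS (p ^ 2 - y ^ 2)).differentiableAt.hasDerivAt
  refine ((hasDerivAt_neg y).mul (hSS.comp y ((hasDerivAt_pow 2 y).const_sub (p ^ 2)))
    ).congr_deriv ?_
  simp only [profile, Function.comp_apply]
  norm_num
  linear_combination CC_sub_SS (p ^ 2 - y ^ 2)

-- Variation of constants: `f'(τ) sin (σ + v - τ) + f(τ) cos (σ + v - τ)` has the derivative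
-- `g(τ) sin (σ + v - τ)`.
lemma mul_cos_add_mul_sin_lt_of_hasDerivAt {f f' g : ℝ → ℝ} {σ v : ℝ} (hv : 0 < v) (hvπ : v ≤ π)
    (hf : ∀ τ, HasDerivAt f (f' τ) τ) (hf' : ∀ τ, HasDerivAt f' (g τ - f τ) τ)
    (hg : ∀ τ ∈ Ioo σ (σ + v), 0 < g τ) :
    f σ * Real.cos v + f' σ * Real.sin v < f (σ + v) := by
  have hL : ∀ τ, HasDerivAt
      (fun τ => f' τ * Real.sin (σ + v - τ) + f τ * Real.cos (σ + v - τ))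
      (g τ * Real.sin (σ + v - τ)) τ := fun τ => by
    have hτ := (hasDerivAt_id' τ).const_sub (σ + v)
    refine (((hf' τ).mul hτ.sin).add ((hf τ).mul hτ.cos)).congr_deriv ?_
    ring
  have hmono := strictMonoOn_of_deriv_pos (convex_Icc σ (σ + v))
    (fun τ _ => (hL τ).continuousAt.continuousWithinAt) (fun τ hτ => by
      rw [interior_Icc] at hτ
      rw [(hL τ).deriv]
      exact mul_pos (hg τ hτ)
        (Real.sin_pos_of_pos_of_lt_pi (by linarith [hτ.2]) (by linarith [hτ.1])))
  have h := hmono (left_mem_Icc.2 (by linarith)) (right_mem_Icc.2 (by linarith))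
    (lt_add_of_pos_right σ hv)
  simp only [sub_self, Real.sin_zero, Real.cos_zero, add_sub_cancel_left] at h
  linarith

section TangentProfile

variable {p σ v : ℝ} (hp : 0 < p) (hppi : p < π) (hσ : σ ^ 2 ≤ p ^ 2)

include hp hppi hσ

lemma tangentProfile_lt_profile (hv : 0 < v) (hvπ : v ≤ π) (hy : σ + v ≤ π) :
    tangentProfile p σ v < profile p (σ + v) := by
  have h := mul_cos_add_mul_sin_lt_of_hasDerivAt hv hvπ (hasDerivAt_profile p)
    (hasDerivAt_neg_mul_SS p) fun τ hτ => by
      have hτπ : τ ^ 2 < π ^ 2 :=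
        sq_lt_sq' (by linarith [hτ.1, (abs_le_of_sq_le_sq' hσ hp.le).1]) (hτ.2.trans_le hy)
      exact mul_pos (by positivity) (deriv_SS_pos (by nlinarith))
  unfold tangentProfile
  linarith

lemma tangentProfile_lt_one (hv : 0 ≤ v) (hvπ : v ≤ π) (hy : π ≤ σ + v) :
    tangentProfile p σ v < 1 := by
  have hσp := (abs_le_of_sq_le_sq' hσ hp.le).2
  have hSS : 0 < SS (p ^ 2 - σ ^ 2) := SS_pos (by nlinarith [Real.pi_pos])
  have hCC : 1 ≤ profile p σ := by
    rw [profile, ← Real.sq_sqrt (sub_nonneg.2 hσ), CC_sq]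
    exact Real.one_le_cosh _
  have hσ0 : 0 ≤ σ := by linarith
  rcases le_total v (π / 2) with hv2 | hv2
  · calc tangentProfile p σ v ≤ tangentProfile p σ (π - σ) := by
          have hc : Real.cos v ≤ Real.cos (π - σ) :=
            Real.cos_le_cos_of_nonneg_of_le_pi (by linarith) (by linarith) (by linarith)
          have hs : Real.sin (π - σ) ≤ Real.sin v :=
            Real.sin_le_sin_of_le_of_le_pi_div_two (by linarith) (by linarith) (by linarith)
          unfold tangentProfile
          gcongr
      _ < profile p (σ + (π - σ)) :=
          tangentProfile_lt_profile hp hppi hσ (by linarith) (by linarith) (by linarith)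
      _ ≤ CC 0 := strictMonoOn_CC.monotoneOn (by simp only [mem_Ici]; nlinarith)
          (by simp only [mem_Ici]; nlinarith) (by nlinarith)
      _ = 1 := CC_zero
  · have hc := Real.cos_nonpos_of_pi_div_two_le_of_le hv2 (by linarith)
    have hs := Real.sin_nonneg_of_nonneg_of_le_pi hv hvπ
    have := mul_nonneg (mul_nonneg hσ0 hSS.le) hs
    unfold tangentProfile
    nlinarith

lemma sq_add_sq_le_of_cosh_le_tangentProfile {u : ℝ} (hv : |v| ≤ π)
    (hu : Real.cosh u ≤ tangentProfile p σ v) :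
    u ^ 2 + (σ + v) ^ 2 ≤ p ^ 2 ∧ (u ^ 2 + (σ + v) ^ 2 = p ^ 2 → v = 0) := by
  wlog hv0 : 0 ≤ v generalizing σ v with reflect
  · have h := @reflect (-σ) (-v) (by rwa [neg_sq]) (by rwa [abs_neg])
      (by simpa [tangentProfile, profile] using hu) (by linarith)
    rwa [← neg_add, neg_sq, neg_eq_zero] at h
  rw [abs_of_nonneg hv0] at hv
  have hy : σ + v < π := by
    by_contra! hy
    linarith [tangentProfile_lt_one hp hppi hσ hv0 hv hy, Real.one_le_cosh u]
  have hy2 : (σ + v) ^ 2 < π ^ 2 :=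
    sq_lt_sq' (by linarith [(abs_le_of_sq_le_sq' hσ hp.le).1]) hy
  have hu2 : u ^ 2 ∈ Ici (-π ^ 2) := by simp only [mem_Ici]; nlinarith
  have hpy : p ^ 2 - (σ + v) ^ 2 ∈ Ici (-π ^ 2) := by simp only [mem_Ici]; nlinarith
  rw [← CC_sq] at hu
  rcases hv0.eq_or_lt with rfl | hv0
  · simp only [tangentProfile, profile, Real.cos_zero, Real.sin_zero, mul_one, mul_zero,
      sub_zero] at hu
    rw [add_zero] at hpy ⊢
    exact ⟨by linarith [(strictMonoOn_CC.le_iff_le hu2 hpy).1 hu], fun _ => rfl⟩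
  · have h := (strictMonoOn_CC.lt_iff_lt hu2 hpy).1
      (hu.trans_lt (tangentProfile_lt_profile hp hppi hσ hv0 hv hy.le))
    exact ⟨by linarith, fun h' => by linarith⟩

end TangentProfile

/-! ### The boundary curve -/

lemma gam_eq_exp_circleMap (p t : ℝ) : gam p t = Complex.exp (circleMap 0 p t) := by
  rw [gam, circleMap_zero, Complex.exp_mul_I, ← Complex.ofReal_cos, ← Complex.ofReal_sin]
  push_cast
  ring_nf

lemma gam_pi_sub (p t : ℝ) : gam p (π - t) =
    Complex.exp (((-(p * Real.cos t) : ℝ) : ℂ) + Complex.I * ((p * Real.sin t : ℝ) : ℂ)) := by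
  rw [gam, Real.cos_pi_sub, Real.sin_pi_sub, mul_neg]

lemma gam_eq_or_eq_gam_pi_sub_of_sin_eq {s t : ℝ} (p : ℝ) (h : Real.sin s = Real.sin t) :
    gam p s = gam p t ∨ gam p s = gam p (π - t) := by
  have hsq : Real.cos s ^ 2 = Real.cos t ^ 2 := by rw [Real.cos_sq', Real.cos_sq', h]
  rw [gam_pi_sub, gam, gam, h]
  exact (sq_eq_sq_iff_eq_or_eq_neg.1 hsq).imp (fun hc => by rw [hc])
    (fun hc => by rw [hc, mul_neg])

lemma inversion_gam (p t : ℝ) :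
    EuclideanGeometry.inversion (0 : ℂ) 1 (gam p t) = gam p (π - t) := by
  rw [gam_pi_sub, gam, EuclideanGeometry.inversion_def]
  simp only [dist_zero_right, vsub_eq_sub, sub_zero, vadd_eq_add, add_zero, Complex.real_smul,
    Complex.norm_exp, Complex.add_re, Complex.ofReal_re, Complex.mul_re, Complex.I_re, zero_mul,
    Complex.I_im, Complex.ofReal_im, mul_zero, sub_zero, one_div, ← Real.exp_neg,
    ← Real.exp_nat_mul, Complex.ofReal_exp, ← Complex.exp_add]
  congr 1
  push_cast
  ring

lemma log_exp_of_norm_lt_pi {w : ℂ} (hw : ‖w‖ < π) : Complex.log (Complex.exp w) = w :=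
  have h := abs_lt.1 ((Complex.abs_im_le_norm w).trans_lt hw)
  Complex.log_exp h.1 h.2.le

lemma injOn_exp_ball : InjOn Complex.exp (ball 0 π) :=
  LeftInvOn.injOn fun _ hw => log_exp_of_norm_lt_pi (mem_ball_zero_iff.1 hw)

lemma exp_mem_slitPlane_of_norm_lt_pi {w : ℂ} (hw : ‖w‖ < π) :
    Complex.exp w ∈ Complex.slitPlane := by
  rw [Complex.mem_slitPlane_iff_arg, ← Complex.log_im, log_exp_of_norm_lt_pi hw]
  exact ⟨((le_abs_self _).trans_lt ((Complex.abs_im_le_norm w).trans_lt hw)).ne,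
    Complex.exp_ne_zero w⟩

lemma isClosed_expDisk (p : ℝ) : IsClosed (expDisk p) :=
  ((isCompact_closedBall (0 : ℂ) p).image Complex.continuous_exp).isClosed

section Boundary

variable {p : ℝ} (hp : 0 < p) (hppi : p < π)

include hp hppi

lemma norm_circleMap_zero_lt_pi (t : ℝ) : ‖circleMap 0 p t‖ < π := by
  rwa [norm_circleMap_zero, abs_of_pos hp]

lemma log_gam (t : ℝ) : Complex.log (gam p t) = circleMap 0 p t := by
  rw [gam_eq_exp_circleMap, log_exp_of_norm_lt_pi (norm_circleMap_zero_lt_pi hp hppi t)]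

lemma gam_mem_slitPlane (t : ℝ) : gam p t ∈ Complex.slitPlane := by
  rw [gam_eq_exp_circleMap]
  exact exp_mem_slitPlane_of_norm_lt_pi (norm_circleMap_zero_lt_pi hp hppi t)

lemma gam_eq_gam_pi_sub_iff (t : ℝ) : gam p t = gam p (π - t) ↔ Real.cos t = 0 := by
  refine ⟨fun h => ?_, fun h => by rw [gam_pi_sub, gam, h, mul_zero, neg_zero]⟩
  have hre := congrArg (fun z => (Complex.log z).re) h
  simp only [log_gam hp hppi, circleMap_zero_re, Real.cos_pi_sub] at hre
  nlinarith

lemma interior_expDisk : interior (expDisk p) = Complex.exp '' ball 0 p := by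
  refine Subset.antisymm (fun z hz => ?_) (interior_maximal (image_mono ball_subset_closedBall)
    (Complex.isOpenMap_exp _ isOpen_ball))
  have hsub : Complex.exp ⁻¹' interior (expDisk p) ∩ ball 0 π ⊆ closedBall 0 p := by
    rintro x ⟨hx, hxπ⟩
    obtain ⟨y, hy, hyx⟩ := interior_subset hx
    rwa [← injOn_exp_ball (closedBall_subset_ball hppi hy) hxπ hyx]
  obtain ⟨w, hw, rfl⟩ := interior_subset hz
  refine mem_image_of_mem _ ?_
  rw [← interior_closedBall (0 : ℂ) hp.ne']
  exact interior_maximal hsub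
    ((isOpen_interior.preimage Complex.continuous_exp).inter isOpen_ball)
    ⟨hz, closedBall_subset_ball hppi hw⟩

lemma frontier_expDisk_eq_image_sphere : frontier (expDisk p) = Complex.exp '' sphere 0 p := by
  rw [(isClosed_expDisk p).frontier_eq, interior_expDisk hp hppi, expDisk,
    ← (injOn_exp_ball.mono (closedBall_subset_ball hppi)).image_sdiff_subset ball_subset_closedBall,
    closedBall_sdiff_ball]

lemma frontier_expDisk : frontier (expDisk p) = range (gam p) := by
  rw [frontier_expDisk_eq_image_sphere hp hppi, ← abs_of_pos hp, ← range_circleMap, ← range_comp,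
    abs_of_pos hp]
  exact congrArg range (funext fun t => (gam_eq_exp_circleMap p t).symm)

lemma gam_notMem_interior_expDisk (t : ℝ) : gam p t ∉ interior (expDisk p) := fun h =>
  disjoint_interior_frontier.le_bot ⟨h, frontier_expDisk hp hppi ▸ mem_range_self t⟩

end Boundary

/-- The outer unit normal of the boundary curve `gam p` at the parameter `t`. -/
noncomputable def outerNormal (p t : ℝ) : ℂ := circleMap 0 1 (t + p * Real.sin t)

/-- The speed `|γ_p'(t)|` of the boundary curve. -/
noncomputable def speed (p t : ℝ) : ℝ := p * Real.exp (p * Real.cos t)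

lemma norm_outerNormal (p t : ℝ) : ‖outerNormal p t‖ = 1 := by simp [outerNormal]

lemma speed_pos {p : ℝ} (hp : 0 < p) (t : ℝ) : 0 < speed p t := mul_pos hp (Real.exp_pos _)

lemma circleMap_mul_gam (p t : ℝ) : circleMap 0 p t * gam p t = speed p t • outerNormal p t := by
  simp only [circleMap_zero, gam, speed, outerNormal, Complex.real_smul, Complex.ofReal_mul p,
    Complex.ofReal_exp, Complex.ofReal_one, one_mul, mul_assoc, ← Complex.exp_add]
  push_cast
  ring_nf

lemma hasDerivAt_gam (p t : ℝ) :
    HasDerivAt (gam p) (speed p t • (Complex.I * outerNormal p t)) t := by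
  have h := (hasDerivAt_circleMap 0 p t).cexp
  simp only [← gam_eq_exp_circleMap] at h
  refine h.congr_deriv ?_
  rw [← mul_smul_comm, ← circleMap_mul_gam]
  ring

lemma hasDerivAt_speed (p t : ℝ) : HasDerivAt (speed p) (-(p * Real.sin t) * speed p t) t := by
  refine (((Real.hasDerivAt_cos t).const_mul p).exp.const_mul p).congr_deriv ?_
  rw [speed]
  ring

lemma hasDerivAt_outerNormal (p t : ℝ) :
    HasDerivAt (outerNormal p) ((1 + p * Real.cos t) • (Complex.I * outerNormal p t)) t := by
  have h := (hasDerivAt_circleMap 0 1 (t + p * Real.sin t)).scomp t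
    ((hasDerivAt_id' t).add ((Real.hasDerivAt_sin t).const_mul p))
  refine h.congr_deriv ?_
  rw [mul_comm Complex.I]
  rfl

lemma hasDerivAt_deriv_gam (p t : ℝ) : HasDerivAt (deriv (gam p))
    (-(p * Real.sin t) • (speed p t • (Complex.I * outerNormal p t))
      - (speed p t * (1 + p * Real.cos t)) • outerNormal p t) t := by
  have h := (hasDerivAt_speed p t).smul ((hasDerivAt_outerNormal p t).const_mul Complex.I)
  rw [show deriv (gam p) = fun t => speed p t • (Complex.I * outerNormal p t) from
    funext fun t => (hasDerivAt_gam p t).deriv]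
  refine h.congr_deriv ?_
  simp only [Complex.real_smul]
  push_cast
  linear_combination (speed p t * (1 + p * Complex.cos t) * outerNormal p t : ℂ) *
    Complex.I_mul_I

/-! ### The disks in logarithmic coordinates -/

lemma sq_sub_mul_sin_sq (p t : ℝ) : p ^ 2 - (p * Real.sin t) ^ 2 = (p * Real.cos t) ^ 2 := by
  linear_combination -p ^ 2 * Real.sin_sq_add_cos_sq t

lemma profile_mul_sin (p t : ℝ) : profile p (p * Real.sin t) = Real.cosh (p * Real.cos t) := by
  rw [profile, sq_sub_mul_sin_sq, CC_sq]

lemma omega_eq (p t : ℝ) : omega p t = p * SS (p ^ 2 - (p * Real.sin t) ^ 2) := by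
  rw [omega, sq_sub_mul_sin_sq]
  split_ifs with h
  · simp [h, SS_zero]
  · rw [div_eq_iff h, ← mul_SS_sq]
    ring

lemma omega_mul_cos (p t : ℝ) : omega p t * Real.cos t = Real.sinh (p * Real.cos t) := by
  rw [omega_eq, sq_sub_mul_sin_sq, ← mul_SS_sq]
  ring

lemma Omega_eq (p t : ℝ) : Omega p t = Complex.exp (Complex.I * (p * Real.sin t : ℝ)) *
    (Real.cosh (p * Real.cos t) - Complex.I * (omega p t * Real.sin t : ℝ)) := by
  rw [Omega, omega]
  split_ifs with h
  · have hs : Real.sin t ^ 2 = 1 := by rw [Real.sin_sq, h]; norm_num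
    rw [h, mul_zero, Real.cosh_zero, mul_comm Complex.I, Complex.exp_mul_I, ← Complex.ofReal_cos,
      ← Complex.ofReal_sin]
    rcases sq_eq_one_iff.1 hs with h1 | h1 <;> rw [h1] <;> apply Complex.ext <;> simp <;> ring
  · rw [div_mul_eq_mul_div]

lemma Omega_omega_eq_of_cos_sin {s t : ℝ} (p : ℝ) (hc : Real.cos s = -Real.cos t)
    (hs : Real.sin s = Real.sin t) : Omega p s = Omega p t ∧ omega p s = omega p t := by
  simp [Omega, omega, hc, hs, neg_div, div_neg]

lemma disk_eq_of_sin_eq {s t : ℝ} (p : ℝ) (h : Real.sin s = Real.sin t) : disk p s = disk p t := by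
  have hsq : Real.cos s ^ 2 = Real.cos t ^ 2 := by rw [Real.cos_sq', Real.cos_sq', h]
  rcases sq_eq_sq_iff_eq_or_eq_neg.1 hsq with hc | hc
  · rw [disk, disk, Omega, Omega, omega, omega, h, hc]
  · obtain ⟨hΩ, hω⟩ := Omega_omega_eq_of_cos_sin p hc h
    rw [disk, disk, hΩ, hω]

lemma omega_pos {p : ℝ} (hp : 0 < p) (t : ℝ) : 0 < omega p t := by
  rw [omega_eq, sq_sub_mul_sin_sq]
  exact mul_pos hp (SS_pos (lt_of_lt_of_le (by simp [Real.pi_pos]) (sq_nonneg _)))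

lemma gam_eq_circleMap (p t : ℝ) :
    gam p t = circleMap (Omega p t) (omega p t) (t + p * Real.sin t) := by
  have hexp : Complex.exp (t * Complex.I) = Real.cos t + Real.sin t * Complex.I := by
    rw [Complex.exp_mul_I, Complex.ofReal_cos, Complex.ofReal_sin]
  have hsinh := congrArg ((↑) : ℝ → ℂ) (omega_mul_cos p t)
  have hcosh := congrArg ((↑) : ℝ → ℂ) (Real.cosh_add_sinh (p * Real.cos t))
  rw [Complex.ofReal_mul] at hsinh
  rw [Complex.ofReal_add, Complex.ofReal_exp] at hcosh
  rw [circleMap, Omega_eq, gam, Complex.exp_add, ← hcosh, ← hsinh, Complex.ofReal_add,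
    add_mul (t : ℂ), Complex.exp_add, hexp, mul_comm Complex.I]
  push_cast
  ring

lemma gam_eq_add_smul (p t : ℝ) : gam p t = Omega p t + omega p t • outerNormal p t := by
  rw [gam_eq_circleMap, outerNormal, circleMap, circleMap_zero, Complex.real_smul,
    Complex.ofReal_one, one_mul]

lemma cosh_sq_add_omega_mul_sin_sq (p t : ℝ) :
    Real.cosh (p * Real.cos t) ^ 2 + (omega p t * Real.sin t) ^ 2 = 1 + omega p t ^ 2 := by
  rw [Real.cosh_sq, ← omega_mul_cos]
  linear_combination omega p t ^ 2 * Real.sin_sq_add_cos_sq t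

lemma norm_Omega_sq (p t : ℝ) : ‖Omega p t‖ ^ 2 = 1 + omega p t ^ 2 := by
  rw [Omega_eq, norm_mul, mul_comm Complex.I, Complex.norm_exp_ofReal_mul_I, one_mul,
    ← cosh_sq_add_omega_mul_sin_sq, ← Complex.normSq_eq_norm_sq, Complex.normSq_apply]
  simp only [Complex.sub_re, Complex.sub_im, Complex.ofReal_re, Complex.ofReal_im, Complex.mul_re,
    Complex.mul_im, Complex.I_re, Complex.I_im]
  ring

-- The condition on the center says that the circle is orthogonal to the unit circle.
lemma norm_exp_sub_sq {A B r σ u v : ℝ} (h : A ^ 2 + B ^ 2 = 1 + r ^ 2) :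
    ‖Complex.exp (u + Complex.I * (σ + v)) - Complex.exp (Complex.I * σ) * (A - Complex.I * B)‖ ^ 2
      = r ^ 2 + 2 * Real.exp u * (Real.cosh u - (A * Real.cos v - B * Real.sin v)) := by
  have hrot : Complex.exp (u + Complex.I * (σ + v)) - Complex.exp (Complex.I * σ) *
      (A - Complex.I * B) = Complex.exp (σ * Complex.I) *
        (Real.exp u * (Real.cos v + Real.sin v * Complex.I) - (A - Complex.I * B)) := by
    rw [Complex.ofReal_exp, Complex.ofReal_cos, Complex.ofReal_sin, ← Complex.exp_mul_I,
      ← Complex.exp_add, mul_sub (Complex.exp _) (Complex.exp _), ← Complex.exp_add]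
    ring_nf
  rw [hrot, norm_mul, Complex.norm_exp_ofReal_mul_I, one_mul, ← Complex.normSq_eq_norm_sq,
    Complex.normSq_apply]
  simp only [Complex.sub_re, Complex.mul_re, Complex.ofReal_re, Complex.add_re, Complex.I_re,
    Complex.ofReal_im, Complex.I_im, Complex.sub_im, Complex.mul_im, Complex.add_im, mul_zero,
    zero_mul, mul_one, one_mul, sub_zero, add_zero, zero_add, zero_sub]
  have hexp : Real.exp u * Real.exp (-u) = 1 := by
    rw [← Real.exp_add, add_neg_cancel, Real.exp_zero]
  rw [Real.cosh_eq]
  linear_combination h + Real.exp u ^ 2 * Real.cos_sq_add_sin_sq v - hexp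

lemma exists_exp_eq (σ : ℝ) {z : ℂ} (hz : z ≠ 0) :
    ∃ u v : ℝ, |v| ≤ π ∧ Complex.exp (u + Complex.I * (σ + v)) = z := by
  obtain ⟨y, hy⟩ : ∃ y, z * Complex.exp (-(Complex.I * σ)) = y := ⟨_, rfl⟩
  have hy0 : y ≠ 0 := hy ▸ mul_ne_zero hz (Complex.exp_ne_zero _)
  refine ⟨(Complex.log y).re, y.arg, Complex.abs_arg_le_pi y, ?_⟩
  rw [← Complex.log_im, mul_add, add_left_comm, mul_comm Complex.I (Complex.im _ : ℂ),
    Complex.re_add_im, Complex.exp_add, Complex.exp_log hy0, ← hy, mul_left_comm,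
    ← Complex.exp_add, add_neg_cancel, Complex.exp_zero, mul_one]

section Disk

variable {p : ℝ} (hp : 0 < p)

include hp

lemma gam_mem_disk (t : ℝ) : gam p t ∈ disk p t := by
  rw [gam_eq_circleMap]
  exact circleMap_mem_closedBall _ (omega_pos hp t).le _

lemma exp_mem_disk_iff (t u v : ℝ) :
    Complex.exp (u + Complex.I * ((p * Real.sin t : ℝ) + v)) ∈ disk p t ↔
      Real.cosh u ≤ tangentProfile p (p * Real.sin t) v := by
  rw [disk, mem_closedBall_iff_norm, ← sq_le_sq₀ (norm_nonneg _) (omega_pos hp t).le, Omega_eq,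
    norm_exp_sub_sq (cosh_sq_add_omega_mul_sin_sq p t), add_le_iff_nonpos_right,
    ← neg_nonneg, ← mul_neg, mul_nonneg_iff_of_pos_left (by positivity), neg_nonneg, sub_nonpos,
    tangentProfile, profile_mul_sin, omega_eq]
  ring_nf

lemma zero_notMem_disk (t : ℝ) : (0 : ℂ) ∉ disk p t := by
  rw [disk, mem_closedBall_iff_norm, zero_sub, norm_neg,
    ← sq_le_sq₀ (norm_nonneg _) (omega_pos hp t).le, norm_Omega_sq]
  linarith

end Disk

section MaximalDisks

variable {p : ℝ} (hp : 0 < p) (hppi : p < π)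

include hp hppi

lemma exists_exp_eq_of_mem_disk {t : ℝ} {z : ℂ} (hz : z ∈ disk p t) :
    ∃ w, Complex.exp w = z ∧ ‖w‖ ≤ p ∧ (‖w‖ = p → w.im = p * Real.sin t) := by
  obtain ⟨u, v, hv, rfl⟩ := exists_exp_eq (p * Real.sin t)
    (ne_of_mem_of_not_mem hz (zero_notMem_disk hp t))
  have hσ : (p * Real.sin t) ^ 2 ≤ p ^ 2 := by
    linarith [sq_sub_mul_sin_sq p t, sq_nonneg (p * Real.cos t)]
  have h := sq_add_sq_le_of_cosh_le_tangentProfile hp hppi hσ hv ((exp_mem_disk_iff hp t u v).1 hz)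
  have hnorm : ‖(u + Complex.I * ((p * Real.sin t : ℝ) + v) : ℂ)‖ ^ 2
      = u ^ 2 + (p * Real.sin t + v) ^ 2 := by
    rw [mul_comm, ← Complex.ofReal_add, Complex.sq_norm, Complex.normSq_add_mul_I]
  refine ⟨_, rfl, ?_, fun hw => ?_⟩
  · exact (sq_le_sq₀ (norm_nonneg _) hp.le).1 (hnorm.trans_le h.1)
  · rw [h.2 (hnorm.symm.trans (by rw [hw])), Complex.ofReal_zero, add_zero, Complex.add_im,
      Complex.ofReal_im, zero_add, Complex.I_mul_im, Complex.ofReal_re]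

lemma disk_subset_expDisk (t : ℝ) : disk p t ⊆ expDisk p := fun _ hz =>
  let ⟨w, hwz, hw, _⟩ := exists_exp_eq_of_mem_disk hp hppi hz
  ⟨w, mem_closedBall_zero_iff.2 hw, hwz⟩

lemma gam_mem_disk_iff {s t : ℝ} : gam p s ∈ disk p t ↔ Real.sin s = Real.sin t := by
  refine ⟨fun h => ?_, fun h => ?_⟩
  · obtain ⟨w, hws, hw, him⟩ := exists_exp_eq_of_mem_disk hp hppi h
    have hlog := congrArg Complex.log hws
    rw [log_exp_of_norm_lt_pi (hw.trans_lt hppi), log_gam hp hppi] at hlog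
    subst hlog
    have := him (by rw [norm_circleMap_zero, abs_of_pos hp])
    rw [circleMap_zero_im] at this
    exact mul_left_cancel₀ hp.ne' this
  · rw [← disk_eq_of_sin_eq p h]
    exact gam_mem_disk hp s

lemma disk_inter_frontier (t : ℝ) :
    disk p t ∩ frontier (expDisk p) = {gam p t, gam p (π - t)} := by
  rw [frontier_expDisk hp hppi]
  apply Subset.antisymm
  · rintro _ ⟨h, s, rfl⟩
    exact gam_eq_or_eq_gam_pi_sub_of_sin_eq p ((gam_mem_disk_iff hp hppi).1 h)
  · rintro _ (rfl | rfl)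
    · exact ⟨gam_mem_disk hp t, mem_range_self _⟩
    · exact ⟨(gam_mem_disk_iff hp hppi).2 (Real.sin_pi_sub t), mem_range_self _⟩

lemma injOn_disk : InjOn (disk p) (Icc (-(π / 2)) (π / 2)) := fun s hs _ ht h =>
  Real.injOn_sin hs ht ((gam_mem_disk_iff hp hppi).1 (h ▸ gam_mem_disk hp s))

lemma isDiskIn_disk (t : ℝ) : IsDiskIn (expDisk p) (disk p t) :=
  ⟨⟨_, _, (omega_pos hp t).le, rfl⟩, disk_subset_expDisk hp hppi t⟩

end MaximalDisks

/-! ### Balls touching a curve or a level set -/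

section TouchingBalls

variable {E : Type*} [NormedAddCommGroup E]

lemma closedBall_sub_smul_subset [NormedSpace ℝ E] {z e : E} {r r' : ℝ} (he : ‖e‖ = 1)
    (hr : r ≤ r') : closedBall (z - r • e) r ⊆ closedBall (z - r' • e) r' := by
  refine closedBall_subset_closedBall' ?_
  rw [dist_sub_left, dist_eq_norm, ← sub_smul, norm_smul, he, mul_one, Real.norm_eq_abs,
    abs_sub_comm, abs_of_nonneg (sub_nonneg.2 hr), add_sub_cancel]

lemma mem_ball_sub_smul_of_lt [NormedSpace ℝ E] [StrictConvexSpace ℝ E] {z e q : E} {r r' : ℝ}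
    (he : ‖e‖ = 1) (hr : 0 < r) (hrr : r < r') (hq : q ∈ closedBall (z - r • e) r) (hqz : q ≠ z) :
    q ∈ ball (z - r' • e) r' := by
  have hr' := hr.trans hrr
  have hz : z ∈ closedBall (z - r' • e) r' := by
    rw [mem_closedBall_iff_norm, sub_sub_cancel, norm_smul, he, mul_one, Real.norm_of_nonneg hr'.le]
  have hq' : z + (r' / r) • (q - z) ∈ closedBall (z - r' • e) r' := by
    have h : z + (r' / r) • (q - z) - (z - r' • e) = (r' / r) • (q - (z - r • e)) := by
      rw [← sub_add, ← sub_add, smul_add, smul_smul, div_mul_cancel₀ _ hr.ne']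
      abel
    rw [mem_closedBall_iff_norm] at hq ⊢
    rw [h, norm_smul, Real.norm_of_nonneg (by positivity)]
    calc r' / r * ‖q - (z - r • e)‖ ≤ r' / r * r := by gcongr
      _ = r' := div_mul_cancel₀ _ hr.ne'
  rw [← interior_closedBall _ hr'.ne']
  refine (strictConvex_closedBall ℝ _ _).openSegment_subset hz hq' (fun h => hqz ?_) ?_
  · rw [left_eq_add, smul_eq_zero_iff_right (div_pos hr' hr).ne'] at h
    exact sub_eq_zero.1 h
  · rw [openSegment_eq_image']
    exact ⟨r / r', ⟨by positivity, (div_lt_one hr').2 hrr⟩, by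
      simp [smul_smul, hr.ne', hr'.ne']⟩

variable [InnerProductSpace ℝ E]

lemma eq_sub_smul_of_le_inner {z c e : E} {r : ℝ} (he : ‖e‖ = 1)
    (hz : z ∈ closedBall c r) (h : r ≤ inner ℝ (z - c) e) : c = z - r • e := by
  have hr : 0 ≤ r := nonempty_closedBall.1 ⟨z, hz⟩
  have hzc := pow_le_pow_left₀ (norm_nonneg _) (mem_closedBall_iff_norm.1 hz) 2
  have hsq : ‖z - c - r • e‖ ^ 2 = 0 := by
    refine le_antisymm ?_ (sq_nonneg _)
    rw [norm_sub_sq_real, real_inner_smul_right, norm_smul, he, mul_one, Real.norm_eq_abs, sq_abs]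
    nlinarith
  rw [sq_eq_zero_iff, norm_eq_zero] at hsq
  rw [eq_sub_iff_add_eq, ← sub_eq_zero, ← neg_eq_zero, ← hsq]
  abel

lemma eq_sub_smul_of_isLocalMaxOn_closedBall {f : E → ℝ} {z c e : E} {r a : ℝ} (ha : 0 < a)
    (he : ‖e‖ = 1) (hf : HasFDerivAt f (a • innerSL ℝ e) z) (hz : z ∈ closedBall c r)
    (hmax : IsLocalMaxOn f (closedBall c r) z) : c = z - r • e := by
  have hr : 0 ≤ r := nonempty_closedBall.1 ⟨z, hz⟩
  have hy : c + r • e ∈ closedBall c r := by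
    rw [mem_closedBall_iff_norm, add_sub_cancel_left, norm_smul, he, mul_one,
      Real.norm_of_nonneg hr]
  have h := hmax.hasFDerivWithinAt_nonpos hf.hasFDerivWithinAt
    (sub_mem_posTangentConeAt_of_segment_subset ((convex_closedBall c r).segment_subset hz hy))
  refine eq_sub_smul_of_le_inner he hz ?_
  have h' : inner ℝ e (c + r • e - z) ≤ 0 := nonpos_of_mul_nonpos_right h ha
  rw [add_sub_right_comm, inner_add_right, real_inner_smul_right, real_inner_self_eq_norm_sq, he,
    ← neg_sub, inner_neg_right, real_inner_comm] at h'
  linarith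

lemma deriv_deriv_nonneg_of_isLocalMin {f : ℝ → ℝ} {t : ℝ} (hf : ContinuousAt f t)
    (h : IsLocalMin f t) : 0 ≤ deriv (deriv f) t := by
  by_contra! hneg
  have hmax := isLocalMax_of_deriv_deriv_neg hneg h.deriv_eq_zero hf
  have hconst : f =ᶠ[𝓝 t] fun _ => f t := by
    filter_upwards [h, hmax] with x hx hx' using le_antisymm hx' hx
  have : deriv (deriv f) t = 0 := by
    rw [hconst.deriv.deriv_eq]
    simp
  exact hneg.ne this

lemma sq_norm_add_inner_nonneg_of_isLocalMin {c c' : ℝ → E} {c'' a : E} {t : ℝ}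
    (hc : ∀ᶠ x in 𝓝 t, HasDerivAt c (c' x) x) (hc' : HasDerivAt c' c'' t)
    (h : IsLocalMin (fun x => ‖c x - a‖ ^ 2) t) : 0 ≤ ‖c' t‖ ^ 2 + inner ℝ (c t - a) c'' := by
  have hct := hc.self_of_nhds.sub_const a
  have hd : deriv (fun x => ‖c x - a‖ ^ 2) =ᶠ[𝓝 t] fun x => 2 * inner ℝ (c x - a) (c' x) := by
    filter_upwards [hc] with x hx using ((hx.sub_const a).norm_sq).deriv
  have h' := deriv_deriv_nonneg_of_isLocalMin hct.norm_sq.continuousAt h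
  rw [hd.deriv_eq, ((hct.inner ℝ hc').const_mul 2).deriv, real_inner_self_eq_norm_sq] at h'
  linarith

end TouchingBalls

/-! ### Maximal disks -/

lemma inner_I_mul_self (z : ℂ) : inner ℝ z (Complex.I * z) = 0 := by
  simp [Complex.inner, mul_comm]

lemma inner_inv_mul_right (w z h : ℂ) : inner ℝ w (z⁻¹ * h) = inner ℝ (w * z) h / ‖z‖ ^ 2 := by
  rw [Complex.inner, Complex.inner, Complex.inv_def, map_mul, Complex.normSq_eq_norm_sq,
    div_eq_mul_inv, ← Complex.re_mul_ofReal]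
  ring_nf

section Touching

variable {p : ℝ} (hp : 0 < p) (hppi : p < π)

include hp hppi

lemma hasFDerivAt_norm_log_sq_gam (t : ℝ) :
    HasFDerivAt (fun z => ‖Complex.log z‖ ^ 2)
      ((2 * speed p t / ‖gam p t‖ ^ 2) • innerSL ℝ (outerNormal p t)) (gam p t) := by
  have hlog := (Complex.hasDerivAt_log (gam_mem_slitPlane hp hppi t)).hasFDerivAt.restrictScalars ℝ
  refine hlog.norm_sq.congr_fderiv (ContinuousLinearMap.ext fun h => ?_)
  change (2 : ℕ) • inner ℝ (Complex.log (gam p t)) (h * (gam p t)⁻¹) =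
    2 * speed p t / ‖gam p t‖ ^ 2 * inner ℝ (outerNormal p t) h
  rw [log_gam hp hppi, mul_comm h, inner_inv_mul_right, circleMap_mul_gam, real_inner_smul_left,
    two_nsmul]
  ring

lemma center_eq_of_gam_mem_closedBall {c : ℂ} {r t : ℝ} (hD : closedBall c r ⊆ expDisk p)
    (hz : gam p t ∈ closedBall c r) : c = gam p t - r • outerNormal p t := by
  have hgam : 0 < ‖gam p t‖ := norm_pos_iff.2 (Complex.exp_ne_zero _)
  have hspeed := speed_pos hp t
  refine eq_sub_smul_of_isLocalMaxOn_closedBall (by positivity) (norm_outerNormal p t)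
    (hasFDerivAt_norm_log_sq_gam hp hppi t) hz (IsMaxOn.localize fun z hzD => ?_)
  obtain ⟨w, hw, rfl⟩ := hD hzD
  rw [mem_closedBall_zero_iff] at hw
  simp only [mem_ofPred_eq]
  rw [log_gam hp hppi, norm_circleMap_zero, abs_of_pos hp,
    log_exp_of_norm_lt_pi (hw.trans_lt hppi)]
  gcongr

-- The boundary curve stays outside of the open ball, so it curves at most as much as the ball.
lemma radius_mul_le_of_gam_mem_closedBall {c : ℂ} {r t : ℝ} (hD : closedBall c r ⊆ expDisk p)
    (hz : gam p t ∈ closedBall c r) : r * (1 + p * Real.cos t) ≤ speed p t := by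
  have hmin : IsLocalMin (fun x => ‖gam p x - c‖ ^ 2) t := .of_forall fun x => by
    have hx : gam p x ∉ ball c r := fun h => gam_notMem_interior_expDisk hp hppi x
      (interior_maximal (ball_subset_closedBall.trans hD) isOpen_ball h)
    rw [mem_ball_iff_norm, not_lt] at hx
    exact pow_le_pow_left₀ (norm_nonneg _) ((mem_closedBall_iff_norm.1 hz).trans hx) 2
  have h := sq_norm_add_inner_nonneg_of_isLocalMin
    (.of_forall fun x => (hasDerivAt_gam p x).differentiableAt.hasDerivAt)
    (hasDerivAt_deriv_gam p t) hmin
  rw [(hasDerivAt_gam p t).deriv, center_eq_of_gam_mem_closedBall hp hppi hD hz, sub_sub_cancel,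
    norm_smul, norm_mul, Complex.norm_I, norm_outerNormal, one_mul, mul_one, inner_sub_right,
    real_inner_smul_left, real_inner_smul_left] at h
  simp only [real_inner_smul_right, inner_I_mul_self, real_inner_self_eq_norm_sq,
    norm_outerNormal, Real.norm_of_nonneg (speed_pos hp t).le] at h
  exact le_of_mul_le_mul_left (by linarith) (speed_pos hp t)

lemma closedBall_subset_disk_of_gam_mem {c : ℂ} {r t : ℝ} (hD : closedBall c r ⊆ expDisk p)
    (hz : gam p t ∈ closedBall c r) : closedBall c r ⊆ disk p t := by
  have hΩ : Omega p t = gam p t - omega p t • outerNormal p t :=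
    eq_sub_of_add_eq (gam_eq_add_smul p t).symm
  have hc := center_eq_of_gam_mem_closedBall hp hppi hD hz
  suffices r ≤ omega p t by
    rw [disk, hΩ, hc]
    exact closedBall_sub_smul_subset (norm_outerNormal p t) this
  by_cases hcos : Real.cos t = 0
  · have h := radius_mul_le_of_gam_mem_closedBall hp hppi hD hz
    simpa [hcos, speed, omega] using h
  by_contra! hr
  have hmem : gam p (π - t) ∈ closedBall (gam p t - omega p t • outerNormal p t) (omega p t) :=
    hΩ ▸ (gam_mem_disk_iff hp hppi).2 (Real.sin_pi_sub t)
  have hball := mem_ball_sub_smul_of_lt (norm_outerNormal p t) (omega_pos hp t) hr hmem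
    fun h => hcos ((gam_eq_gam_pi_sub_iff hp hppi t).1 h.symm)
  rw [← hc] at hball
  exact gam_notMem_interior_expDisk hp hppi _
    (interior_maximal (ball_subset_closedBall.trans hD) isOpen_ball hball)

end Touching

lemma exists_closedBall_inter_frontier_nonempty {E : Type*} [NormedAddCommGroup E]
    [NormedSpace ℝ E] [ProperSpace E] {K : Set E} (hK : IsClosed K) (hne : Kᶜ.Nonempty) {c : E}
    {r : ℝ} (hr : 0 ≤ r) (h : closedBall c r ⊆ K) :
    ∃ r', r ≤ r' ∧ closedBall c r' ⊆ K ∧ (closedBall c r' ∩ frontier K).Nonempty := by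
  have hsub : closedBall c (infDist c Kᶜ) ⊆ K := by
    rcases (infDist_nonneg (x := c) (s := Kᶜ)).eq_or_lt with h0 | h0
    · rw [← h0, closedBall_zero]
      exact singleton_subset_iff.2 (h (mem_closedBall_self hr))
    · rw [← closure_ball c h0.ne']
      exact hK.closure_subset_iff.2 ball_infDist_compl_subset
  obtain ⟨z, hz, hd⟩ := isClosed_closure.exists_infDist_eq_dist hne.closure c
  rw [infDist_closure] at hd
  have hzb : z ∈ closedBall c (infDist c Kᶜ) := mem_closedBall'.2 hd.ge
  refine ⟨infDist c Kᶜ, (le_infDist hne).2 fun y hy => ?_, hsub, z, hzb, ?_⟩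
  · by_contra! hlt
    exact hy (h (mem_closedBall'.2 hlt.le))
  · rw [frontier_eq_closure_inter_closure]
    exact ⟨subset_closure (hsub hzb), hz⟩

section MaximalDisks

variable {p : ℝ} (hp : 0 < p) (hppi : p < π)

include hp hppi

lemma exists_subset_disk {D : Set ℂ} (hD : IsDiskIn (expDisk p) D) :
    ∃ t ∈ Icc (-(π / 2)) (π / 2), D ⊆ disk p t := by
  obtain ⟨⟨c, r, hr, rfl⟩, hD⟩ := hD
  have hne : (expDisk p)ᶜ.Nonempty := ⟨0, fun ⟨w, _, hw⟩ => Complex.exp_ne_zero w hw⟩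
  obtain ⟨r', hrr, hD', z, hzD, hz⟩ :=
    exists_closedBall_inter_frontier_nonempty (isClosed_expDisk p) hne hr hD
  rw [frontier_expDisk hp hppi] at hz
  obtain ⟨τ, rfl⟩ := hz
  have hsin : Real.sin (Real.arcsin (Real.sin τ)) = Real.sin τ :=
    Real.sin_arcsin (Real.neg_one_le_sin τ) (Real.sin_le_one τ)
  refine ⟨Real.arcsin (Real.sin τ), Real.arcsin_mem_Icc _, ?_⟩
  rw [disk_eq_of_sin_eq p hsin]
  exact (closedBall_subset_closedBall hrr).trans
    (closedBall_subset_disk_of_gam_mem hp hppi hD' hzD)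

lemma setOf_isMaximalDiskIn :
    {D : Set ℂ | IsMaximalDiskIn (expDisk p) D} = disk p '' Icc (-(π / 2)) (π / 2) := by
  ext D
  constructor
  · intro hD
    obtain ⟨t, ht, h⟩ := exists_subset_disk hp hppi hD.prop
    exact ⟨t, ht, (hD.eq_of_subset (isDiskIn_disk hp hppi t) h).symm⟩
  · rintro ⟨t, ht, rfl⟩
    refine ⟨isDiskIn_disk hp hppi t, fun D hD hsub => ?_⟩
    obtain ⟨s, hs, h⟩ := exists_subset_disk hp hppi hD
    rwa [Real.injOn_sin ht hs ((gam_mem_disk_iff hp hppi).1 (h (hsub (gam_mem_disk hp t))))]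

end MaximalDisks

/-! ### Tangency, osculation and orthogonality -/

lemma isLocalParam_const_add {f : ℝ → ℂ} {S : Set ℂ} {t : ℝ} (hf : ContDiff ℝ 2 f)
    (hderiv : deriv f t ≠ 0) (hmap : map f (𝓝 t) = 𝓝[S] (f t)) :
    IsLocalParam (fun x => f (t + x)) S (f t) where
  map_zero := by rw [add_zero]
  contDiffAt := (hf.comp (contDiff_const.add contDiff_id)).contDiffAt
  deriv_ne_zero := by rwa [deriv_comp_const_add, add_zero]
  map_nhds := by
    rw [← hmap, ← map_add_left_nhds_zero t, map_map]
    rfl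

lemma signedCurvature_comp_const_add (f : ℝ → ℂ) (t x : ℝ) :
    signedCurvature (fun y => f (t + y)) x = signedCurvature f (t + x) := by
  have hderiv : deriv (fun y => f (t + y)) = fun y => deriv f (t + y) :=
    funext fun y => deriv_comp_const_add f t y
  simp only [signedCurvature, hderiv, deriv_comp_const_add (deriv f)]

lemma map_circleMap_nhds (c : ℂ) {R : ℝ} (hR : 0 < R) (θ : ℝ) :
    map (circleMap c R) (𝓝 θ) = 𝓝[sphere c R] circleMap c R θ := by
  let e : ℂ ≃ₜ ℂ :=
    (Homeomorph.mulLeft₀ (R : ℂ) (mod_cast hR.ne')).trans (Homeomorph.addLeft c)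
  have hemb : Topology.IsEmbedding fun z : Circle => e z :=
    e.isEmbedding.comp .subtypeVal
  have hcomp : circleMap c R = (fun z : Circle => e (z : ℂ)) ∘ Circle.exp :=
    funext fun x => by simp [e, circleMap]
  have hrange : range (fun z : Circle => e (z : ℂ)) = sphere c R := by
    have hsphere := range_circleMap c R
    rwa [hcomp, Circle.exp_surjective.range_comp, abs_of_pos hR] at hsphere
  rw [hcomp, ← map_map, isLocalHomeomorph_circleExp.map_nhds_eq, hemb.map_nhds_eq, hrange]
  rfl

lemma isLocalParam_circleMap (c : ℂ) {R : ℝ} (hR : 0 < R) (θ : ℝ) :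
    IsLocalParam (fun x => circleMap c R (θ + x)) (sphere c R) (circleMap c R θ) :=
  isLocalParam_const_add (contDiff_circleMap c R) (deriv_circleMap_ne_zero hR.ne')
    (map_circleMap_nhds c hR θ)

lemma contDiff_gam (p : ℝ) {n : WithTop ℕ∞} : ContDiff ℝ n (gam p) := by
  rw [show gam p = fun t => Complex.exp (circleMap 0 p t) from funext (gam_eq_exp_circleMap p)]
  exact (contDiff_circleMap 0 p).cexp

lemma deriv_gam_ne_zero {p : ℝ} (hp : 0 < p) (t : ℝ) : deriv (gam p) t ≠ 0 := by
  rw [(hasDerivAt_gam p t).deriv, ← norm_ne_zero_iff, norm_smul, norm_mul, Complex.norm_I,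
    norm_outerNormal, one_mul, mul_one]
  exact norm_ne_zero_iff.2 (speed_pos hp t).ne'

section Frontier

variable {p : ℝ} (hp : 0 < p) (hppi : p < π)

include hp hppi

lemma map_gam_nhds (t : ℝ) : map (gam p) (𝓝 t) = 𝓝[frontier (expDisk p)] gam p t := by
  have hinv : LeftInvOn Complex.log Complex.exp (sphere 0 p) := fun w hw =>
    log_exp_of_norm_lt_pi (by rwa [mem_sphere_zero_iff_norm.1 hw])
  have hlog : ContinuousAt Complex.log (Complex.exp (circleMap 0 p t)) :=
    continuousAt_clog (gam_eq_exp_circleMap p t ▸ gam_mem_slitPlane hp hppi t)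
  rw [show gam p = Complex.exp ∘ circleMap 0 p from funext (gam_eq_exp_circleMap p), ← map_map,
    map_circleMap_nhds 0 hp, hinv.map_nhdsWithin_eq
      (hinv (circleMap_mem_sphere 0 hp.le t)) hlog.continuousWithinAt
      Complex.continuous_exp.continuousWithinAt, frontier_expDisk_eq_image_sphere hp hppi]
  rfl

lemma isLocalParam_gam (t : ℝ) :
    IsLocalParam (fun x => gam p (t + x)) (frontier (expDisk p)) (gam p t) :=
  isLocalParam_const_add (contDiff_gam p) (deriv_gam_ne_zero hp t) (map_gam_nhds hp hppi t)

lemma isTangentAt_gam (t : ℝ) :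
    IsTangentAt (sphere (Omega p t) (omega p t)) (frontier (expDisk p)) (gam p t) := by
  have hω := omega_pos hp t
  refine ⟨_, _, gam_eq_circleMap p t ▸ isLocalParam_circleMap _ hω _, isLocalParam_gam hp hppi t,
    omega p t / speed p t, (div_pos hω (speed_pos hp t)).ne', ?_⟩
  rw [deriv_comp_const_add, deriv_comp_const_add, add_zero, add_zero, deriv_circleMap,
    (hasDerivAt_gam p t).deriv, smul_smul, div_mul_cancel₀ _ (speed_pos hp t).ne', outerNormal,
    Complex.real_smul, circleMap_zero, circleMap_zero, Complex.ofReal_one]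
  ring

lemma isTangentAt_gam_pi_sub (t : ℝ) :
    IsTangentAt (sphere (Omega p t) (omega p t)) (frontier (expDisk p)) (gam p (π - t)) := by
  obtain ⟨hΩ, hω⟩ := Omega_omega_eq_of_cos_sin p (Real.cos_pi_sub t) (Real.sin_pi_sub t)
  rw [← hΩ, ← hω]
  exact isTangentAt_gam hp hppi (π - t)

end Frontier

lemma signedCurvature_gam {p : ℝ} (hp : 0 < p) (t : ℝ) :
    signedCurvature (gam p) t = (1 + p * Real.cos t) / speed p t := by
  have hv := speed_pos hp t
  have hN : starRingEnd ℂ (outerNormal p t) * outerNormal p t = 1 := by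
    rw [Complex.conj_mul', norm_outerNormal, Complex.ofReal_one, one_pow]
  have hprod : starRingEnd ℂ (deriv (gam p) t) * deriv (deriv (gam p)) t =
      ((speed p t ^ 2 * -(p * Real.sin t) : ℝ) : ℂ)
        + ((speed p t ^ 2 * (1 + p * Real.cos t) : ℝ) : ℂ) * Complex.I := by
    rw [(hasDerivAt_gam p t).deriv, (hasDerivAt_deriv_gam p t).deriv]
    simp only [Complex.real_smul, map_mul, Complex.conj_ofReal, Complex.conj_I]
    push_cast
    linear_combination (speed p t ^ 2 * (-(p * Complex.sin t)
      + (1 + p * Complex.cos t) * Complex.I) : ℂ) * hN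
      + (speed p t ^ 2 * (p * Complex.sin t) * starRingEnd ℂ (outerNormal p t) * outerNormal p t
        : ℂ) * Complex.I_mul_I
  have hnorm : ‖deriv (gam p) t‖ = speed p t := by
    rw [(hasDerivAt_gam p t).deriv, norm_smul, norm_mul, Complex.norm_I, norm_outerNormal, one_mul,
      mul_one, Real.norm_of_nonneg hv.le]
  rw [signedCurvature, hprod, hnorm, Complex.add_im, Complex.ofReal_im, zero_add,
    Complex.im_ofReal_mul, Complex.I_im, mul_one]
  field_simp

lemma isOsculatingDisk_gam {p : ℝ} (hp : 0 < p) (hppi : p < π) {t : ℝ} (ht : Real.cos t = 0) :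
    IsOsculatingDisk (Omega p t) (omega p t) (frontier (expDisk p)) (gam p t) := by
  have hω : omega p t = p := if_pos ht
  have hspeed : speed p t = p := by rw [speed, ht, mul_zero, Real.exp_zero, mul_one]
  have hderiv : deriv (fun x => gam p (t + x)) 0 = p • (Complex.I * outerNormal p t) := by
    rw [deriv_comp_const_add, add_zero, (hasDerivAt_gam p t).deriv, hspeed]
  have hcurv : signedCurvature (fun x => gam p (t + x)) 0 = p⁻¹ := by
    rw [signedCurvature_comp_const_add, add_zero, signedCurvature_gam hp, hspeed, ht, mul_zero,
      add_zero, one_div]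
  refine ⟨_, isLocalParam_gam hp hppi t, hcurv ▸ inv_ne_zero hp.ne', ?_, ?_⟩
  · have hdir : p • (Complex.I * outerNormal p t) / (p : ℂ) = Complex.I * outerNormal p t := by
      rw [Complex.real_smul, mul_div_cancel_left₀ _ (mod_cast hp.ne')]
    rw [hcurv, inv_inv, hderiv, norm_smul, norm_mul, Complex.norm_I, norm_outerNormal, mul_one,
      mul_one, Real.norm_of_nonneg hp.le, hdir, ← mul_assoc, Complex.I_mul_I, neg_one_mul,
      smul_neg, gam_eq_add_smul, hω, add_neg_cancel_right]
  · rw [hcurv, hω, abs_inv, inv_inv, abs_of_pos hp]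

lemma cos_eq_zero_iff_of_mem_Icc {t : ℝ} (ht : t ∈ Icc (-(π / 2)) (π / 2)) :
    Real.cos t = 0 ↔ t = -(π / 2) ∨ t = π / 2 := by
  refine ⟨fun h => ?_, by rintro (rfl | rfl) <;> simp⟩
  rcases eq_endpoints_or_mem_Ioo_of_mem_Icc ht with ht | ht | ht
  · exact .inl ht
  · exact .inr ht
  · exact absurd h (Real.cos_pos_of_mem_Ioo ht).ne'

lemma circlesOrthogonal_of_norm_sub_sq {a b : ℂ} {r ρ : ℝ} (hr : 0 ≤ r) (hρ : 0 < ρ)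
    (h : ‖a - b‖ ^ 2 = r ^ 2 + ρ ^ 2) : CirclesOrthogonal a r b ρ := by
  have hd : 0 < ‖a - b‖ := (norm_nonneg _).lt_of_ne' fun h0 => by
    rw [h0] at h
    nlinarith
  constructor
  · have hnorm : ‖(ρ + r * Complex.I : ℂ)‖ = ‖a - b‖ := by
      rw [Complex.norm_add_mul_I, add_comm, ← h, Real.sqrt_sq hd.le]
    have hd0 : (‖a - b‖ : ℂ) ≠ 0 := mod_cast hd.ne'
    have hsq : (‖a - b‖ : ℂ) ^ 2 = r ^ 2 + ρ ^ 2 := mod_cast h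
    have hsub : b + ρ * (ρ + r * Complex.I) * (a - b) / (‖a - b‖ : ℂ) ^ 2 - a =
        r * Complex.I * (ρ + r * Complex.I) * (a - b) / (‖a - b‖ : ℂ) ^ 2 := by
      field_simp
      linear_combination (a - b) * (-hsq - r ^ 2 * Complex.I_sq)
    refine ⟨b + ρ * (ρ + r * Complex.I) * (a - b) / (‖a - b‖ : ℂ) ^ 2, ?_, ?_⟩
    · rw [mem_sphere_iff_norm, hsub]
      simp only [norm_div, norm_mul, norm_pow, hnorm, Complex.norm_real, Complex.norm_I, norm_norm,
        Real.norm_of_nonneg hr]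
      field_simp
    · rw [mem_sphere_iff_norm, add_sub_cancel_left]
      simp only [norm_div, norm_mul, norm_pow, hnorm, Complex.norm_real, norm_norm,
        Real.norm_of_nonneg hρ.le]
      field_simp
  · rintro z ⟨hza, hzb⟩
    rw [mem_sphere_iff_norm] at hza hzb
    have hcos := norm_sub_sq_real (z - a) (z - b)
    rw [sub_sub_sub_cancel_left, norm_sub_rev, h, hza, hzb] at hcos
    linarith

/-! ### Time-ordered exponentials -/

section OrderedIntegral

variable {𝔸 : Type*} [NormedRing 𝔸] [NormedAlgebra ℝ 𝔸]

/-- The integral of `φ(θ₁) ⋯ φ(θₙ) B(θₙ)` over the simplex `x ≥ θ₁ ≥ ⋯ ≥ θₙ ≥ a` in a Banach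
algebra; for `n = 0` it is `B x`. With `B = 1` it is the `n`-th term of the left time-ordered
exponential of `φ`, and general `B` also expresses the remainders of that series. -/
noncomputable def orderedIntegral (φ B : ℝ → 𝔸) (a : ℝ) : ℕ → ℝ → 𝔸
  | 0, x => B x
  | n + 1, x => ∫ θ in a..x, φ θ * orderedIntegral φ B a n θ

variable {φ A B : ℝ → 𝔸} {a b : ℝ}

lemma continuous_orderedIntegral (hφ : Continuous φ) (hB : Continuous B) (a : ℝ) (n : ℕ) :
    Continuous (orderedIntegral φ B a n) := by
  induction n with
  | zero => exact hB
  | succ n ih =>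
    exact intervalIntegral.continuous_primitive (fun _ _ => (hφ.mul ih).intervalIntegrable _ _) a

lemma norm_orderedIntegral_le {M K : ℝ} (hφ : ∀ x ∈ Icc a b, ‖φ x‖ ≤ M)
    (hB : ∀ x ∈ Icc a b, ‖B x‖ ≤ K) (n : ℕ) :
    ∀ x ∈ Icc a b, ‖orderedIntegral φ B a n x‖ ≤ K * ((M * (x - a)) ^ n / n.factorial) := by
  induction n with
  | zero => simpa [orderedIntegral] using hB
  | succ n ih =>
    intro x hx
    have hbound : ∀ θ ∈ Ioc a x, ‖φ θ * orderedIntegral φ B a n θ‖ ≤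
        M * (K * (M ^ n / n.factorial)) * (θ - a) ^ n := fun θ hθ => by
      have hθ' : θ ∈ Icc a b := ⟨hθ.1.le, hθ.2.trans hx.2⟩
      refine (norm_mul_le_of_le (hφ θ hθ') (ih θ hθ')).trans_eq ?_
      rw [mul_pow]
      ring
    refine (intervalIntegral.norm_integral_le_of_norm_le hx.1 (.of_forall hbound)
      (Continuous.intervalIntegrable (by fun_prop) _ _)).trans_eq ?_
    rw [intervalIntegral.integral_const_mul, intervalIntegral.integral_comp_sub_right (· ^ n),
      integral_pow, sub_self, zero_pow n.succ_ne_zero, sub_zero, Nat.factorial_succ, mul_pow]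
    push_cast
    field_simp
    ring

variable [CompleteSpace 𝔸]

lemma orderedIntegral_eq_add_of_hasDerivAt (hφ : Continuous φ)
    (hA : ∀ x, HasDerivAt A (φ x * A x) x) (a : ℝ) (n : ℕ) (x : ℝ) :
    orderedIntegral φ A a n x =
      orderedIntegral φ (fun _ => A a) a n x + orderedIntegral φ A a (n + 1) x := by
  have hAcont : Continuous A := continuous_iff_continuousAt.2 fun x => (hA x).continuousAt
  induction n generalizing x with
  | zero =>
    simp only [orderedIntegral]
    rw [intervalIntegral.integral_eq_sub_of_hasDerivAt (fun y _ => hA y)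
      ((hφ.mul hAcont).intervalIntegrable a x), add_sub_cancel]
  | succ n ih =>
    have hadd := intervalIntegral.integral_add (μ := MeasureTheory.volume)
      ((hφ.mul (continuous_orderedIntegral hφ (continuous_const (y := A a)) a n)).intervalIntegrable
        a x)
      ((hφ.mul (continuous_orderedIntegral hφ hAcont a (n + 1))).intervalIntegrable a x)
    simp only [Pi.mul_apply, ← mul_add, ← ih] at hadd
    exact hadd

lemma sum_orderedIntegral_of_hasDerivAt (hφ : Continuous φ)
    (hA : ∀ x, HasDerivAt A (φ x * A x) x) (a : ℝ) (n : ℕ) (x : ℝ) :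
    ∑ k ∈ Finset.range n, orderedIntegral φ (fun _ => A a) a k x =
      A x - orderedIntegral φ A a n x := by
  induction n with
  | zero => simp [orderedIntegral]
  | succ n ih =>
    rw [Finset.sum_range_succ, ih, orderedIntegral_eq_add_of_hasDerivAt hφ hA]
    abel

lemma hasSum_orderedIntegral_of_hasDerivAt (hφ : Continuous φ)
    (hA : ∀ x, HasDerivAt A (φ x * A x) x) (hab : a ≤ b) :
    HasSum (fun n => orderedIntegral φ (fun _ => A a) a n b) (A b) := by
  have hAcont : Continuous A := continuous_iff_continuousAt.2 fun x => (hA x).continuousAt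
  have hb : b ∈ Icc a b := right_mem_Icc.2 hab
  obtain ⟨M, hM⟩ := isCompact_Icc.exists_bound_of_continuousOn (s := Icc a b) hφ.continuousOn
  obtain ⟨K, hK⟩ := isCompact_Icc.exists_bound_of_continuousOn (s := Icc a b) hAcont.continuousOn
  have hsummable : Summable fun n => orderedIntegral φ (fun _ => A a) a n b :=
    .of_norm_bounded ((Real.summable_pow_div_factorial (M * (b - a))).mul_left ‖A a‖) fun n =>
      norm_orderedIntegral_le hM (fun _ _ => le_rfl) n b hb
  have hremainder : Tendsto (fun n => orderedIntegral φ A a n b) atTop (𝓝 0) := by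
    have h := (FloorSemiring.tendsto_pow_div_factorial_atTop (M * (b - a))).const_mul K
    rw [mul_zero] at h
    exact squeeze_zero_norm (fun n => norm_orderedIntegral_le hM hK n b hb) h
  rw [hsummable.hasSum_iff_tendsto_nat]
  simp only [sum_orderedIntegral_of_hasDerivAt hφ hA]
  simpa using hremainder.const_sub (A b)

end OrderedIntegral

section MatrixExponential

open scoped Matrix.Norms.Operator

lemma lexpTerm_eq_orderedIntegral {φ : ℝ → Matrix (Fin 2) (Fin 2) ℝ} (hφ : Continuous φ)
    (a : ℝ) (n : ℕ) : lexpTerm φ a n = orderedIntegral φ (fun _ => 1) a n := by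
  induction n with
  | zero => rfl
  | succ n ih =>
    funext x
    ext i j
    have hint := (hφ.mul (continuous_orderedIntegral hφ
      (continuous_const (y := (1 : Matrix (Fin 2) (Fin 2) ℝ))) a n)).intervalIntegrable
      (μ := MeasureTheory.volume) a x
    rw [lexpTerm, ih, Matrix.of_apply]
    exact (Matrix.entryLinearMap ℝ ℝ i j).toContinuousLinearMap.intervalIntegral_comp_comm hint

lemma hasSum_lexpTerm_of_hasDerivAt {φ A : ℝ → Matrix (Fin 2) (Fin 2) ℝ} {a b : ℝ}
    (hφ : Continuous φ) (hA : ∀ x, HasDerivAt A (φ x * A x) x) (hAa : A a = 1) (hab : a ≤ b) :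
    HasSum (fun n => lexpTerm φ a n b) (A b) := by
  have h := hasSum_orderedIntegral_of_hasDerivAt hφ hA hab
  rw [hAa] at h
  simp only [← lexpTerm_eq_orderedIntegral hφ] at h
  exact h

end MatrixExponential

/-- The rotation matrix of angle `w`, the first factor of `W p w`. -/
noncomputable def rotation (w : ℝ) : Matrix (Fin 2) (Fin 2) ℝ :=
  !![Real.cos w, -Real.sin w; Real.sin w, Real.cos w]

/-- The second factor of `W p (p * s)`, the exponential of `x • !![0, 1 + s; 1 - s, 0]`. -/
noncomputable def boost (s x : ℝ) : Matrix (Fin 2) (Fin 2) ℝ :=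
  !![CC ((1 - s ^ 2) * x ^ 2), (1 + s) * (x * SS ((1 - s ^ 2) * x ^ 2));
     (1 - s) * (x * SS ((1 - s ^ 2) * x ^ 2)), CC ((1 - s ^ 2) * x ^ 2)]

lemma W_eq_rotation_mul_boost (s x : ℝ) : W x (x * s) = rotation (x * s) * boost s x := by
  rw [W, rotation, boost, show x ^ 2 - (x * s) ^ 2 = (1 - s ^ 2) * x ^ 2 by ring]
  ring_nf

lemma hasDerivAt_matrix_fin_two {a b c d : ℝ → ℝ} {a' b' c' d' x : ℝ} (ha : HasDerivAt a a' x)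
    (hb : HasDerivAt b b' x) (hc : HasDerivAt c c' x) (hd : HasDerivAt d d' x) :
    HasDerivAt (fun x => !![a x, b x; c x, d x]) !![a', b'; c', d'] x := by
  refine hasDerivAt_pi.2 fun i => hasDerivAt_pi.2 fun j => ?_
  fin_cases i <;> fin_cases j <;> assumption

lemma hasDerivAt_rotation (w : ℝ) : HasDerivAt rotation (rotation w * !![0, -1; 1, 0]) w := by
  have hcos := Real.hasDerivAt_cos w
  have hsin := Real.hasDerivAt_sin w
  have hmul : rotation w * !![0, -1; 1, 0] =
      !![-Real.sin w, -Real.cos w; Real.cos w, -Real.sin w] := by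
    simp [rotation]
  rw [hmul]
  exact hasDerivAt_matrix_fin_two hcos hsin.neg hsin hcos

lemma hasDerivAt_CC_mul_sq (c x : ℝ) :
    HasDerivAt (fun x => CC (c * x ^ 2)) (c * (x * SS (c * x ^ 2))) x := by
  refine ((hasDerivAt_CC _).comp x ((hasDerivAt_pow 2 x).const_mul c)).congr_deriv ?_
  push_cast
  ring

lemma hasDerivAt_boost (s x : ℝ) :
    HasDerivAt (boost s) (!![0, 1 + s; 1 - s, 0] * boost s x) x := by
  have hC := hasDerivAt_CC_mul_sq (1 - s ^ 2) x
  have hS := hasDerivAt_mul_SS (1 - s ^ 2) x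
  have hmul : !![0, 1 + s; 1 - s, 0] * boost s x =
      !![(1 - s ^ 2) * (x * SS ((1 - s ^ 2) * x ^ 2)), (1 + s) * CC ((1 - s ^ 2) * x ^ 2);
         (1 - s) * CC ((1 - s ^ 2) * x ^ 2), (1 - s ^ 2) * (x * SS ((1 - s ^ 2) * x ^ 2))] := by
    rw [boost, Matrix.mul_fin_two]
    ring_nf
  rw [hmul]
  exact hasDerivAt_matrix_fin_two hC (hS.const_mul (1 + s)) (hS.const_mul (1 - s)) hC

lemma Phi_mul_rotation (s x : ℝ) :
    Phi s x * rotation (x * s) = rotation (x * s) * !![0, 1; 1, 0] := by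
  have hsin := Real.sin_sub (2 * (x * s)) (x * s)
  have hcos := Real.cos_sub (2 * (x * s)) (x * s)
  rw [two_mul, add_sub_cancel_right, ← two_mul] at hsin hcos
  rw [Phi, rotation, Matrix.mul_fin_two, Matrix.mul_fin_two]
  congrm !![?_, ?_; ?_, ?_] <;> linarith

lemma continuous_Phi (s : ℝ) : Continuous (Phi s) :=
  continuous_matrix fun i j => by
    fin_cases i <;> fin_cases j <;> simp only [Phi] <;> dsimp <;> fun_prop

open scoped Matrix.Norms.Operator in
lemma hasDerivAt_W (s x : ℝ) :
    HasDerivAt (fun x => W x (x * s)) (Phi s x * W x (x * s)) x := by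
  have hrot : HasDerivAt (fun x => rotation (x * s))
      (s • (rotation (x * s) * !![0, -1; 1, 0])) x :=
    (hasDerivAt_rotation (x * s)).scomp (h := fun x => x * s) x (hasDerivAt_mul_const s)
  have hgen : s • !![0, -1; 1, 0] + !![0, 1 + s; 1 - s, 0] = !![0, 1; (1 : ℝ), 0] := by
    ext i j
    fin_cases i <;> fin_cases j <;> simp
  simp only [W_eq_rotation_mul_boost]
  refine (hrot.mul (hasDerivAt_boost s x)).congr_deriv ?_
  rw [← mul_assoc (Phi s x), Phi_mul_rotation, ← hgen, mul_add, add_mul, mul_smul_comm]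
  simp only [mul_assoc]

lemma hasSum_lexpTerm_Phi {p : ℝ} (hp : 0 ≤ p) (s : ℝ) :
    HasSum (fun n => lexpTerm (Phi s) 0 n p) (W p (p * s)) := by
  have hW : W 0 (0 * s) = 1 := by
    simp [W, CC_zero, Matrix.one_fin_two]
  exact hasSum_lexpTerm_of_hasDerivAt (continuous_Phi s) (hasDerivAt_W s) hW hp

lemma chiralDisk_W {p : ℝ} (hp : 0 < p) (t : ℝ) :
    chiralDisk (W p (p * Real.sin t)) = disk p t := by
  have hω : p * SS ((p * Real.cos t) ^ 2) = omega p t := by rw [omega_eq, sq_sub_mul_sin_sq]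
  rw [disk, chiralDisk]
  congr 1
  · rw [Omega_eq, mul_comm Complex.I, Complex.exp_mul_I, ← Complex.ofReal_cos,
      ← Complex.ofReal_sin, ← hω]
    simp only [W, sq_sub_mul_sin_sq, CC_sq]
    apply Complex.ext <;>
      simp [Matrix.mul_apply, Fin.sum_univ_two, -Complex.ofReal_cos, -Complex.ofReal_sin,
        -Complex.ofReal_mul] <;> ring
  · rw [← Real.sqrt_sq (omega_pos hp t).le, ← hω]
    congr 1
    simp only [W, sq_sub_mul_sin_sq]
    simp [Matrix.mul_apply, Fin.sum_univ_two]
    linear_combination (p * SS ((p * Real.cos t) ^ 2)) ^ 2 *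
      Real.cos_sq_add_sin_sq (p * Real.sin t)

end MagnusDisks

theorem mainTheorem8 (p : ℝ) (hp0 : 0 < p) (hppi : p < Real.pi) :
    -- (a) tangency, inversion, osculation, orthogonality
    (∀ t ∈ Set.Icc (-(Real.pi / 2)) (Real.pi / 2),
      0 < omega p t ∧
      gam p (Real.pi - t) =
        Complex.exp (((-(p * Real.cos t) : ℝ) : ℂ) + Complex.I * ((p * Real.sin t : ℝ) : ℂ)) ∧
      IsTangentAt (Metric.sphere (Omega p t) (omega p t)) (frontier (expDisk p)) (gam p t) ∧
      IsTangentAt (Metric.sphere (Omega p t) (omega p t)) (frontier (expDisk p))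
        (gam p (Real.pi - t)) ∧
      EuclideanGeometry.inversion (0 : ℂ) 1 (gam p t) = gam p (Real.pi - t) ∧
      (gam p t = gam p (Real.pi - t) ↔ t = -(Real.pi / 2) ∨ t = Real.pi / 2) ∧
      (gam p t = gam p (Real.pi - t) →
        IsOsculatingDisk (Omega p t) (omega p t) (frontier (expDisk p)) (gam p t)) ∧
      CirclesOrthogonal (Omega p t) (omega p t) 0 1) ∧
    -- (a) the disks are distinct, and the symmetry of the extended family
    Set.InjOn (disk p) (Set.Icc (-(Real.pi / 2)) (Real.pi / 2)) ∧
    (∀ t ∈ Set.Icc (-Real.pi) Real.pi, ∀ s ∈ Set.Icc (-Real.pi) Real.pi,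
      (s : Real.Angle) = ((Real.pi - t : ℝ) : Real.Angle) →
        Omega p t = Omega p s ∧ omega p t = omega p s) ∧
    -- (b) the disks are the chiral disks of the hyperbolic developments
    (∀ t ∈ Set.Icc (-(Real.pi / 2)) (Real.pi / 2),
      Summable (fun n : ℕ => lexpTerm (Phi (Real.sin t)) 0 n p) ∧
      chiralDisk (lexp (Phi (Real.sin t)) 0 p) = chiralDisk (W p (p * Real.sin t)) ∧
      chiralDisk (W p (p * Real.sin t)) = disk p t) ∧
    -- (c) the disks are exactly the maximal disks, and where they touch the boundary
    {D : Set ℂ | IsMaximalDiskIn (expDisk p) D} =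
      disk p '' Set.Icc (-(Real.pi / 2)) (Real.pi / 2) ∧
    (∀ t ∈ Set.Icc (-(Real.pi / 2)) (Real.pi / 2),
      disk p t ∩ frontier (expDisk p) = {gam p t, gam p (Real.pi - t)}) := by
  refine ⟨fun t ht => ⟨omega_pos hp0 t, gam_pi_sub p t, isTangentAt_gam hp0 hppi t,
    isTangentAt_gam_pi_sub hp0 hppi t, inversion_gam p t, ?_, fun h => ?_,
    circlesOrthogonal_of_norm_sub_sq (omega_pos hp0 t).le one_pos ?_⟩, injOn_disk hp0 hppi,
    fun t _ s _ h => ?_, fun t _ => ?_, setOf_isMaximalDiskIn hp0 hppi,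
    fun t _ => disk_inter_frontier hp0 hppi t⟩
  · rw [gam_eq_gam_pi_sub_iff hp0 hppi, cos_eq_zero_iff_of_mem_Icc ht]
  · exact isOsculatingDisk_gam hp0 hppi ((gam_eq_gam_pi_sub_iff hp0 hppi t).1 h)
  · rw [sub_zero, norm_Omega_sq]
    ring
  · have hcos := congrArg Real.Angle.cos h
    have hsin := congrArg Real.Angle.sin h
    rw [Real.Angle.cos_coe, Real.Angle.cos_coe, Real.cos_pi_sub] at hcos
    rw [Real.Angle.sin_coe, Real.Angle.sin_coe, Real.sin_pi_sub] at hsin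
    exact Omega_omega_eq_of_cos_sin p (by rw [hcos, neg_neg]) hsin.symm
  · have h := hasSum_lexpTerm_Phi hp0.le (Real.sin t)
    exact ⟨h.summable, by rw [lexp, h.tsum_eq], chiralDisk_W hp0 t⟩
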